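/- Let $N \ge 0$, let $S \subset \mathbb{C}^N$ be a smooth (closed) affine algebraic subvariety, not necessarily irreducible or equidimensional, let $f \in \mathbb{C}[z_1,\dots,z_N]$ be a polynomial, and let $g = f|_S : S \to \mathbb{C}$ be its restriction. Equip $S$ with the Riemannian metric induced by the Euclidean metric of $\mathbb{C}^N \simeq \mathbb{R}^{2N}$, and for $z \in S$ let $\operatorname{grad}\operatorname{Re} g(z) \in T_zS$ be the tangent vector that represents the real cotangent vector $d\operatorname{Re} g(z)$ with respect to this metric. Assume that $g$ is tame at infinity, that is, there exist $R > 0$ and $\varepsilon > 0$ such that $$\{\, z \in S \mid \|\operatorname{grad}\operatorname{Re} g(z)\| < \varepsilon,\ \|z\| > R \,\} = \emptyset .$$ Let $\Sigma_g = g(\{z \in S \mid dg(z) = 0\}) \subset \mathbb{C}$ be the set of critical values of $g$, and let $B_g \subset \mathbb{C}$ be the bifurcation set of $g$, i.e. the smallest finite subset $B \subset \mathbb{C}$ such that the restriction $g^{-1}(\mathbb{C}\setminus B) \to \mathbb{C}\setminus B$ of $g$ is a $C^\infty$ locally trivial fibration (fibers are allowed to be empty). Then this smallest finite subset exists and $$B_g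 = \Sigma_g .$$ -/

import Mathlib

open Set MvPolynomial
open scoped ContDiff

noncomputable section

namespace TameMap

/-- Complex affine `N`-space with its standard Hermitian norm. -/
abbrev Aff (N : ℕ) := EuclideanSpace ℂ (Fin N)

variable {N : ℕ}

/-- The value of a polynomial at a point. -/
def ev (p : MvPolynomial (Fin N) ℂ) (z : Aff N) : ℂ :=
  MvPolynomial.eval (fun i => z i) p

/-- The holomorphic differential `dp(z) = ∑ i, (∂p/∂z_i)(z) dz_i`. -/
def differential (p : MvPolynomial (Fin N) ℂ) (z : Aff N) : Aff N →L[ℂ] ℂ :=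
  ∑ i, ev (MvPolynomial.pderiv i p) z • (EuclideanSpace.proj i : Aff N →L[ℂ] ℂ)

/-- `S` is a (Zariski closed) affine subvariety, i.e. the zero set of a set of polynomials.
Neither irreducibility nor equidimensionality is required. -/
def IsAffineSubvariety (S : Set (Aff N)) : Prop :=
  ∃ I : Set (MvPolynomial (Fin N) ℂ), S = {z | ∀ p ∈ I, ev p z = 0}

/-- The polynomials vanishing on `S`. -/
def vanishingPolys (S : Set (Aff N)) : Set (MvPolynomial (Fin N) ℂ) :=
  {p | ∀ z ∈ S, ev p z = 0}

/-- `S` is non-singular at `z` (Jacobian criterion): near `z` it is cut out by polynomials of its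
vanishing ideal whose differentials at `z` are linearly independent. -/
def IsSmoothAt (S : Set (Aff N)) (z : Aff N) : Prop :=
  ∃ (k : ℕ) (p : Fin k → MvPolynomial (Fin N) ℂ),
    (∀ i, p i ∈ vanishingPolys S) ∧
    LinearIndependent ℂ (fun i => differential (p i) z) ∧
    ∃ W : Set (Aff N), IsOpen W ∧ z ∈ W ∧ ∀ w ∈ W, (∀ i, ev (p i) w = 0) → w ∈ S

/-- Smooth affine subvarieties of complex affine space. -/
def IsSmoothAffineSubvariety (S : Set (Aff N)) : Prop :=
  IsAffineSubvariety S ∧ ∀ z ∈ S, IsSmoothAt S z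

/-- The tangent space `T_z S`, as a complex subspace of the ambient space. -/
def tangentSpace (S : Set (Aff N)) (z : Aff N) : Submodule ℂ (Aff N) where
  carrier := {v | ∀ p ∈ vanishingPolys S, differential p z v = 0}
  zero_mem' := by
    intro p _
    simp
  add_mem' := by
    intro v w hv hw p hp
    simp [hv p hp, hw p hp]
  smul_mem' := by
    intro c v hv p hp
    simp [hv p hp]

/-- The differential `dg(z) : T_z S → ℂ` of the restriction `g = f|_S`. -/
def dRestrict (S : Set (Aff N)) (f : MvPolynomial (Fin N) ℂ) (z : Aff N) :
    tangentSpace S z →L[ℂ] ℂ :=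
  (differential f z).comp (tangentSpace S z).subtypeL

/-- The real cotangent vector `d(Re g)(z)` of `S`, regarded as a real manifold. -/
def dRe (S : Set (Aff N)) (f : MvPolynomial (Fin N) ℂ) (z : Aff N) :
    tangentSpace S z →L[ℝ] ℝ :=
  Complex.reCLM.comp ((dRestrict S f z).restrictScalars ℝ)

/-- The gradient `grad (Re g)(z) ∈ T_z S`: the tangent vector representing `d(Re g)(z)` for the
Riemannian metric on `S` induced by the Euclidean metric of the ambient space. -/
def gradRe (S : Set (Aff N)) (f : MvPolynomial (Fin N) ℂ) (z : Aff N) : tangentSpace S z :=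
  letI : InnerProductSpace ℝ (tangentSpace S z) := InnerProductSpace.complexToReal
  letI : CompleteSpace (tangentSpace S z) := FiniteDimensional.complete ℂ _
  (InnerProductSpace.toDual ℝ (tangentSpace S z)).symm (dRe S f z)

/-- Tameness at infinity of `g = f|_S`. -/
def IsTameAtInfinity (S : Set (Aff N)) (f : MvPolynomial (Fin N) ℂ) : Prop :=
  ∃ R > (0 : ℝ), ∃ ε > (0 : ℝ), {z | z ∈ S ∧ ‖gradRe S f z‖ < ε ∧ R < ‖z‖} = ∅

/-- The critical points of `g = f|_S`. -/
def criticalPoints (S : Set (Aff N)) (f : MvPolynomial (Fin N) ℂ) : Set (Aff N) :=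
  {z | z ∈ S ∧ dRestrict S f z = 0}

/-- The set `Σ_g` of critical values of `g = f|_S`. -/
def criticalValues (S : Set (Aff N)) (f : MvPolynomial (Fin N) ℂ) : Set ℂ :=
  ev f '' criticalPoints S f

/-- The inverse image `g⁻¹(V)` of `V` under `g = f|_S`. -/
def preim (S : Set (Aff N)) (f : MvPolynomial (Fin N) ℂ) (V : Set ℂ) : Set (Aff N) :=
  {z | z ∈ S ∧ ev f z ∈ V}

/-- `g = f|_S` is smoothly trivial over `V ∋ τ`: there is a `C^∞` diffeomorphism
`z ↦ (Φ z, g z)` from `g⁻¹(V)` onto `g⁻¹(τ) × V`, with inverse `Ψ`.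
For maps defined on embedded submanifolds, `ContDiffOn ℝ ∞` is smoothness in the sense of
manifolds. Existence of `Ψ` forces `g` to be a submersion over `V`, so that
`g⁻¹(τ)` is an embedded submanifold. -/
def IsTrivialOver (S : Set (Aff N)) (f : MvPolynomial (Fin N) ℂ) (τ : ℂ) (V : Set ℂ) : Prop :=
  ∃ (Φ : Aff N → Aff N) (Ψ : Aff N × ℂ → Aff N),
    MapsTo Φ (preim S f V) (preim S f {τ}) ∧
    MapsTo Ψ (preim S f {τ} ×ˢ V) (preim S f V) ∧
    ContDiffOn ℝ ∞ Φ (preim S f V) ∧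
    ContDiffOn ℝ ∞ Ψ (preim S f {τ} ×ˢ V) ∧
    (∀ z ∈ preim S f V, Ψ (Φ z, ev f z) = z) ∧
    (∀ x ∈ preim S f {τ}, ∀ t ∈ V, Φ (Ψ (x, t)) = x ∧ ev f (Ψ (x, t)) = t)

/-- The restriction `g⁻¹(ℂ \ B) → ℂ \ B` of `g = f|_S` is a `C^∞` locally trivial fibration
(the fibers may be empty). -/
def IsLocallyTrivialOff (S : Set (Aff N)) (f : MvPolynomial (Fin N) ℂ) (B : Set ℂ) : Prop :=
  ∀ τ ∈ Bᶜ, ∃ V : Set ℂ, IsOpen V ∧ τ ∈ V ∧ V ⊆ Bᶜ ∧ IsTrivialOver S f τ V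

/-- The finite sets off which `g = f|_S` is a `C^∞` locally trivial fibration. -/
def exceptionalSets (S : Set (Aff N)) (f : MvPolynomial (Fin N) ℂ) : Set (Set ℂ) :=
  {B | B.Finite ∧ IsLocallyTrivialOff S f B}

/-- The bifurcation set `B_g` of `g = f|_S`: the smallest member of `exceptionalSets S f`,
written as the intersection of all of them. -/
def bifurcationSet (S : Set (Aff N)) (f : MvPolynomial (Fin N) ℂ) : Set ℂ :=
  ⋂₀ exceptionalSets S f

end TameMap

end

/-! Critical values lie in every exceptional set: a trivialization over `V` gives a smooth local
section of `g` through each point over `V`, and its velocity is a tangent vector on which `dg`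
equals 1 (`criticalValues_subset_of_isLocallyTrivialOff`). It remains to see that `Σ_g` is itself
exceptional, which takes two arguments.

Finiteness (`finite_criticalValues`): by tameness the critical points lie in a ball, so `f` is
bounded on them. With Lagrange multipliers as extra variables they become the projection of an
affine variety, and a bounded polynomial on an affine variety takes finitely many values
(`finite_image_of_bounded`).

Triviality (`isLocallyTrivialOff_criticalValues`) is an Ehresmann argument in which tameness
replaces properness. Over a closed disc free of critical values, tangent vectors with `dg = 1` can
be chosen uniformly bounded: by compactness inside a ball, by the gradient estimate outside. A
partition of unity glues them to a bounded ambient field `w` (`exists_lift_field`), so the curves of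
`c • w` exist up to time one. Starting on `S`, they stay on `S` and lie over straight segments while
these stay in the disc (`mem_and_ev_eq_of_integralCurve`). Time-one maps are smooth
(`contDiff_timeOne`), by the implicit function theorem applied to the integral equation in `C([0,1],
E)`. -/

noncomputable section

namespace TameMap
open Filter Topology

/-! ### Smoothness of composition operators on spaces of continuous functions -/

section Superposition

universe u

variable {I : Type*} [TopologicalSpace I]
variable {E F : Type u} [NormedAddCommGroup E] [NormedSpace ℝ E]
  [NormedAddCommGroup F] [NormedSpace ℝ F]

/-- The pointwise application of a continuous family of operators to continuous functions. -/
def pointwiseApply (I : Type*) [TopologicalSpace I] [CompactSpace I] (E F : Type*)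
    [NormedAddCommGroup E] [NormedSpace ℝ E] [NormedAddCommGroup F] [NormedSpace ℝ F] :
    C(I, E →L[ℝ] F) →L[ℝ] C(I, E) →L[ℝ] C(I, F) :=
  LinearMap.mkContinuous₂
    (LinearMap.mk₂ ℝ (fun (A : C(I, E →L[ℝ] F)) (h : C(I, E)) =>
        (⟨fun s => A s (h s), by fun_prop⟩ : C(I, F)))
      (fun _ _ _ => by ext; simp) (fun _ _ _ => by ext; simp)
      (fun _ _ _ => by ext; simp) (fun _ _ _ => by ext; simp)) 1
    (fun A h => by
      rw [one_mul, ContinuousMap.norm_le _ (mul_nonneg (norm_nonneg A) (norm_nonneg h))]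
      intro s
      simp only [LinearMap.mk₂_apply, ContinuousMap.coe_mk]
      exact ((A s).le_opNorm _).trans
        (by gcongr; exacts [A.norm_coe_le_norm s, h.norm_coe_le_norm s]))

@[simp] lemma pointwiseApply_apply [CompactSpace I] (A : C(I, E →L[ℝ] F)) (h : C(I, E)) (s : I) :
    pointwiseApply I E F A h s = A s (h s) := rfl

/-- The superposition operator `γ ↦ X ∘ γ` on continuous functions. -/
def superposition (I : Type*) [TopologicalSpace I] {E F : Type*} [TopologicalSpace E]
    [TopologicalSpace F] (X : C(E, F)) (γ : C(I, E)) : C(I, F) := X.comp γ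

@[simp] lemma superposition_apply {E F : Type*} [TopologicalSpace E]
    [TopologicalSpace F] (X : C(E, F)) (γ : C(I, E)) (s : I) :
    superposition I X γ s = X (γ s) := rfl

lemma continuous_superposition {E F : Type*} [TopologicalSpace E]
    [TopologicalSpace F] (X : C(E, F)) : Continuous (superposition I X) :=
  ContinuousMap.continuous_postcomp X

variable [CompactSpace I]

/-- The mean value inequality is applied on each segment from `γ s` to `γ s + k s`. Continuity of `γ
↦ X' ∘ γ` in the sup norm supplies one `δ` valid for all `s`. -/
lemma hasFDerivAt_superposition (X : C(E, F)) (X' : C(E, E →L[ℝ] F))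
    (hX : ∀ x, HasFDerivAt X (X' x) x) (γ : C(I, E)) :
    HasFDerivAt (superposition I X) (pointwiseApply I E F (superposition I X' γ)) γ := by
  rw [hasFDerivAt_iff_isLittleO_nhds_zero, Asymptotics.isLittleO_iff]
  intro ε hε
  have hc := (continuous_superposition (I := I) X').continuousAt (x := γ)
  obtain ⟨δ, hδ, h⟩ := (Metric.continuousAt_iff (α := C(I, E))
    (β := C(I, E →L[ℝ] F)) (f := superposition I X')).1 hc ε hε
  filter_upwards [Metric.ball_mem_nhds (0 : C(I, E)) hδ] with k hk
  rw [mem_ball_zero_iff] at hk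
  rw [ContinuousMap.norm_le _ (by positivity)]
  intro s
  have hseg : ∀ y ∈ segment ℝ (γ s) (γ s + k s), ‖X' y - X' (γ s)‖ ≤ ε := by
    intro y hy
    rw [segment_eq_image'] at hy
    obtain ⟨θ, hθ, rfl⟩ := hy
    have h1 : dist (γ + θ • k) γ < δ := by
      rw [dist_eq_norm, add_sub_cancel_left, norm_smul, Real.norm_of_nonneg hθ.1]
      exact (mul_le_of_le_one_left (norm_nonneg _) hθ.2).trans_lt hk
    have h2 := (ContinuousMap.dist_apply_le_dist s).trans (h h1).le
    simpa [dist_eq_norm] using h2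
  have := (convex_segment (𝕜 := ℝ) (γ s) (γ s + k s)).norm_image_sub_le_of_norm_hasFDerivWithin_le'
    (f := X) (f' := X') (φ := X' (γ s)) (C := ε)
    (fun x _ => (hX x).hasFDerivWithinAt) hseg (left_mem_segment _ _ _) (right_mem_segment _ _ _)
  simp only [add_sub_cancel_left] at this
  exact this.trans (mul_le_mul_of_nonneg_left (k.norm_coe_le_norm s) hε.le)

/-- The derivative is the superposition operator of `X'` followed by a bounded linear map, which
allows induction. The target must vary, since `X'` takes values in `E →L[ℝ] F`; the common universe
keeps that space in range. -/
lemma contDiff_superposition_nat (n : ℕ) :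
    ∀ {F : Type u} [NormedAddCommGroup F] [NormedSpace ℝ F] (X : C(E, F)),
      ContDiff ℝ n X → ContDiff ℝ n (superposition I X) := by
  induction n with
  | zero =>
    intro F _ _ X _
    exact contDiff_zero.2 (continuous_superposition X)
  | succ n ih =>
    intro F _ _ X hX
    rw [Nat.cast_add, Nat.cast_one, contDiff_succ_iff_fderiv] at hX
    let X' : C(E, E →L[ℝ] F) := ⟨fderiv ℝ X, hX.2.2.continuous⟩
    have hd := hasFDerivAt_superposition (I := I) X X' (fun x => (hX.1 x).hasFDerivAt)
    rw [Nat.cast_add, Nat.cast_one, contDiff_succ_iff_hasFDerivAt]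
    exact ⟨fun γ => pointwiseApply I E F (superposition I X' γ),
      ContDiff.comp (g := pointwiseApply I E F) (ContinuousLinearMap.contDiff _) (ih X' hX.2.2), hd⟩

lemma contDiff_superposition (X : C(E, F)) (hX : ContDiff ℝ ∞ X) :
    ContDiff ℝ ∞ (superposition I X) :=
  contDiff_infty.2 fun n => contDiff_superposition_nat n X (contDiff_infty.1 hX n)

end Superposition

/-! ### Volterra operators and invertibility of the linearized integral equation -/

section Volterra

variable {E : Type*} [NormedAddCommGroup E] [NormedSpace ℝ E]

/-- The primitive of a continuous function on the unit interval. -/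
def primitive (h : C(unitInterval, E)) (t : ℝ) : E := ∫ r in (0 : ℝ)..t, IccExtend zero_le_one h r

lemma continuous_iccExtend {E : Type*} [TopologicalSpace E] (h : C(unitInterval, E)) :
    Continuous (IccExtend (zero_le_one (α := ℝ)) h) := h.continuous.Icc_extend'

lemma hasDerivAt_primitive [CompleteSpace E] (h : C(unitInterval, E)) (t : ℝ) :
    HasDerivAt (primitive h) (IccExtend zero_le_one h t) t :=
  intervalIntegral.integral_hasDerivAt_right ((continuous_iccExtend h).intervalIntegrable _ _)
    (continuous_iccExtend h).stronglyMeasurable.stronglyMeasurableAtFilter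
    (continuous_iccExtend h).continuousAt

lemma continuous_primitive [CompleteSpace E] (h : C(unitInterval, E)) :
    Continuous (primitive h) :=
  continuous_iff_continuousAt.2 fun t => (hasDerivAt_primitive h t).continuousAt

/-- The integration operator on continuous functions on the unit interval. -/
def integration (E : Type*) [NormedAddCommGroup E] [NormedSpace ℝ E] [CompleteSpace E] :
    C(unitInterval, E) →L[ℝ] C(unitInterval, E) :=
  LinearMap.mkContinuous
    { toFun := fun h => ⟨fun s => primitive h s,
        (continuous_primitive h).comp continuous_subtype_val⟩
      map_add' := fun h k => by
        ext s
        exact intervalIntegral.integral_add ((continuous_iccExtend h).intervalIntegrable _ _)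
          ((continuous_iccExtend k).intervalIntegrable _ _)
      map_smul' := fun c h => by
        ext s
        exact intervalIntegral.integral_smul c _ } 1
    (fun h => by
      rw [ContinuousMap.norm_le _ (by positivity)]
      intro s
      refine (intervalIntegral.norm_integral_le_of_norm_le_const (C := ‖h‖)
        fun r _ => h.norm_coe_le_norm _).trans ?_
      rw [sub_zero, abs_of_nonneg s.2.1, one_mul]
      exact mul_le_of_le_one_right (norm_nonneg _) s.2.2)

variable [CompleteSpace E]

lemma integration_apply (h : C(unitInterval, E)) (s : unitInterval) :
    integration E h s = primitive h s := rfl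

/-- The Volterra operator `h ↦ ∫₀ˢ A h`. -/
def volterra (A : C(unitInterval, E →L[ℝ] E)) : C(unitInterval, E) →L[ℝ] C(unitInterval, E) :=
  (integration E).comp (pointwiseApply unitInterval E E A)

/-- The factor `s ^ n / n!` is what iterated integration over `[0, s]` produces. It makes some power
of the operator a contraction however large `‖A‖` is. -/
lemma norm_volterra_pow_apply_le (A : C(unitInterval, E →L[ℝ] E)) (h : C(unitInterval, E))
    (n : ℕ) (s : unitInterval) :
    ‖(volterra A ^ n) h s‖ ≤ (‖A‖ * s) ^ n / n.factorial * ‖h‖ := by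
  induction n generalizing s with
  | zero => simpa using h.norm_coe_le_norm s
  | succ n ih =>
    rw [pow_succ', mul_apply_eq_comp]
    set k := (volterra A ^ n) h
    change ‖∫ r in (0 : ℝ)..s, IccExtend zero_le_one (pointwiseApply unitInterval E E A k) r‖ ≤ _
    have hb : ∀ r ∈ Ioc (0 : ℝ) s,
        ‖IccExtend zero_le_one (pointwiseApply unitInterval E E A k) r‖ ≤
          ‖A‖ ^ (n + 1) / n.factorial * ‖h‖ * r ^ n := by
      intro r hr
      have hr' : r ∈ Icc (0 : ℝ) 1 := ⟨hr.1.le, hr.2.trans s.2.2⟩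
      rw [IccExtend_of_mem _ _ hr', pointwiseApply_apply]
      refine ((A _).le_opNorm _).trans ?_
      calc _ ≤ ‖A‖ * ((‖A‖ * r) ^ n / n.factorial * ‖h‖) :=
            by gcongr; exacts [A.norm_coe_le_norm _, ih ⟨r, hr'⟩]
        _ = _ := by ring
    refine (intervalIntegral.norm_integral_le_of_norm_le s.2.1
      (MeasureTheory.ae_of_all _ hb) (Continuous.intervalIntegrable (by fun_prop) _ _)).trans ?_
    rw [intervalIntegral.integral_const_mul, integral_pow, Nat.factorial_succ]
    apply le_of_eq
    push_cast
    field_simp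
    ring

lemma isUnit_one_sub_volterra (A : C(unitInterval, E →L[ℝ] E)) : IsUnit (1 - volterra A) := by
  have hlim := FloorSemiring.tendsto_pow_div_factorial_atTop ‖A‖
  obtain ⟨n, hn⟩ := (hlim.eventually (gt_mem_nhds zero_lt_one)).exists
  have hV : ‖volterra A ^ n‖ < 1 := by
    refine (ContinuousLinearMap.opNorm_le_bound (M := ‖A‖ ^ n / n.factorial) (volterra A ^ n)
      (by positivity) fun h => ?_).trans_lt hn
    rw [ContinuousMap.norm_le _ (by positivity)]
    intro s
    refine (norm_volterra_pow_apply_le A h n s).trans ?_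
    have := mul_nonneg (norm_nonneg A) s.2.1
    gcongr
    exact mul_le_of_le_one_right (norm_nonneg A) s.2.2
  have hu := isUnit_one_sub_of_norm_lt_one
    (R := C(unitInterval, E) →L[ℝ] C(unitInterval, E)) hV
  -- `1 - V ^ n` is invertible and factors as `1 - V` times a commuting geometric sum, so `1 - V` is
  -- invertible as well.
  have hc : Commute (1 - volterra A) (∑ i ∈ Finset.range n, volterra A ^ i) :=
    Commute.sum_right _ _ _ fun i _ => ((Commute.one_left _).sub_left (Commute.refl _)).pow_right i
  rw [← mul_neg_geom_sum] at hu
  exact (hc.isUnit_mul_iff.1 hu).1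

end Volterra

/-! ### Existence, uniqueness and smooth dependence for ordinary differential equations -/

section Flow

variable {E : Type*} [NormedAddCommGroup E] [NormedSpace ℝ E] [FiniteDimensional ℝ E]

lemma exists_lipschitzOnWith_closedBall {X : E → E} (hX : ContDiff ℝ 1 X) (x : E) (R : ℝ) :
    ∃ K, LipschitzOnWith K X (Metric.closedBall x R) := by
  have : ProperSpace E := FiniteDimensional.proper ℝ E
  exact hX.contDiffOn.exists_lipschitzOnWith one_ne_zero (convex_closedBall x R)
    (isCompact_closedBall x R)

/-- By compactness both curves lie in one ball, on which `X` is Lipschitz; no global Lipschitz bound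
is needed. -/
lemma eqOn_of_hasDerivAt {X : E → E} (hX : ContDiff ℝ 1 X) {f g : ℝ → E} {a b : ℝ}
    (hf : ∀ t ∈ Icc a b, HasDerivAt f (X (f t)) t) (hg : ∀ t ∈ Icc a b, HasDerivAt g (X (g t)) t)
    (h : f a = g a) : EqOn f g (Icc a b) := by
  have hfc : ContinuousOn f (Icc a b) := fun t ht => (hf t ht).continuousAt.continuousWithinAt
  have hgc : ContinuousOn g (Icc a b) := fun t ht => (hg t ht).continuousAt.continuousWithinAt
  obtain ⟨R, hR⟩ := ((isCompact_Icc.image_of_continuousOn hfc).isBounded.union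
    (isCompact_Icc.image_of_continuousOn hgc).isBounded).subset_closedBall 0
  obtain ⟨K, hK⟩ := exists_lipschitzOnWith_closedBall hX 0 R
  exact ODE_solution_unique_of_mem_Icc_right (v := fun _ => X)
    (s := fun _ => Metric.closedBall 0 R) (fun _ _ => hK) hfc
    (fun t ht => (hf t (Ico_subset_Icc_self ht)).hasDerivWithinAt)
    (fun t ht => hR (Or.inl (mem_image_of_mem f (Ico_subset_Icc_self ht)))) hgc
    (fun t ht => (hg t (Ico_subset_Icc_self ht)).hasDerivWithinAt)
    (fun t ht => hR (Or.inr (mem_image_of_mem g (Ico_subset_Icc_self ht)))) h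

lemma exists_integralCurve_of_bounded {X : E → E} (hX : ContDiff ℝ 1 X) {M : ℝ}
    (hM : ∀ x, ‖X x‖ ≤ M) (x : E) :
    ∃ γ : ℝ → E, γ 0 = x ∧ ∀ t ∈ Icc (0 : ℝ) 1, HasDerivAt γ (X (γ t)) t := by
  have : CompleteSpace E := FiniteDimensional.complete ℝ E
  have hM0 : 0 ≤ M := (norm_nonneg _).trans (hM x)
  obtain ⟨K, hK⟩ := exists_lipschitzOnWith_closedBall hX x (2 * M)
  lift M to NNReal using hM0
  -- In time at most 2 a curve of speed at most `M` stays in the ball of radius `2 * M`, so one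
  -- application suffices. The interval `[-1, 2]` makes the derivatives at 0 and 1 two-sided.
  have hP : IsPicardLindelof (fun _ => X) (tmin := -1) (tmax := 2) ⟨0, by norm_num⟩ x
      (2 * M) 0 M K := by
    refine .of_time_independent (fun y _ => hM y) (by simpa using hK) ?_
    norm_num [mul_comm]
  obtain ⟨γ, h0, hγ⟩ := hP.exists_eq_forall_mem_Icc_hasDerivWithinAt₀
  refine ⟨γ, h0, fun t ht => (hγ t ⟨by linarith [ht.1], by linarith [ht.2]⟩).hasDerivAt ?_⟩
  exact Icc_mem_nhds (by linarith [ht.1]) (by linarith [ht.2])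

/-- The time-one map of a smooth vector field is smooth. -/
theorem contDiff_timeOne {X : E → E} (hX : ContDiff ℝ ∞ X) {F : E → ℝ → E}
    (h0 : ∀ x, F x 0 = x) (hF : ∀ x, ∀ t ∈ Icc (0 : ℝ) 1, HasDerivAt (F x) (X (F x t)) t) :
    ContDiff ℝ ∞ fun x => F x 1 := by
  have : CompleteSpace E := FiniteDimensional.complete ℝ E
  have hX1 : ContDiff ℝ 1 X := hX.of_le (by simp)
  let Xc : C(E, E) := ⟨X, hX.continuous⟩
  let X' : C(E, E →L[ℝ] E) := ⟨fderiv ℝ X, hX1.continuous_fderiv one_ne_zero⟩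
  let const : E →L[ℝ] C(unitInterval, E) := ContinuousLinearMap.const ℝ unitInterval
  -- Zeros of `G` are the solutions of the integral equation with initial value `p.1`.
  let G : E × C(unitInterval, E) → C(unitInterval, E) := fun p =>
    p.2 - const p.1 - integration E (superposition unitInterval Xc p.2)
  have hN := contDiff_superposition (I := unitInterval) Xc hX
  have hG : ContDiff ℝ ∞ G :=
    (contDiff_snd.sub (const.contDiff.comp contDiff_fst)).sub
      ((integration E).contDiff.comp (hN.comp contDiff_snd))
  have key : ∀ x γ, G (x, γ) = 0 → ∀ s : unitInterval, γ s = F x s := by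
    intro x γ hγ
    let η : ℝ → E := fun t => x + primitive (superposition unitInterval Xc γ) t
    have hη : ∀ s : unitInterval, η s = γ s := by
      intro s
      have := DFunLike.congr_fun hγ s
      simp only [G, ContinuousMap.sub_apply, integration_apply, ContinuousMap.zero_apply] at this
      rw [sub_sub, sub_eq_zero] at this
      exact this.symm
    have hd : ∀ t ∈ Icc (0 : ℝ) 1, HasDerivAt η (X (η t)) t := by
      intro t ht
      have := (hasDerivAt_primitive (superposition unitInterval Xc γ) t).const_add x
      rw [IccExtend_of_mem _ _ ht] at this
      rw [show η t = γ ⟨t, ht⟩ from hη ⟨t, ht⟩]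
      exact this
    intro s
    rw [← hη s]
    exact eqOn_of_hasDerivAt hX1 hd (hF x) (by simp [η, primitive, h0]) s.2
  rw [contDiff_iff_contDiffAt]
  intro x
  let γ : C(unitInterval, E) := ⟨fun s => F x s, continuous_iff_continuousAt.2 fun s =>
    ContinuousAt.comp (hF x s s.2).continuousAt continuous_subtype_val.continuousAt⟩
  have hGγ : G (x, γ) = 0 := by
    ext s
    have := intervalIntegral.integral_eq_sub_of_hasDerivAt (f := F x) (a := 0) (b := s)
      (f' := IccExtend zero_le_one (superposition unitInterval Xc γ)) (fun t ht => by
        rw [uIcc_of_le s.2.1] at ht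
        have ht' : t ∈ Icc (0 : ℝ) 1 := ⟨ht.1, ht.2.trans s.2.2⟩
        rw [IccExtend_of_mem _ _ ht']
        exact hF x t ht') ((continuous_iccExtend _).intervalIntegrable _ _)
    rw [h0] at this
    change F x s - x - ∫ r in (0 : ℝ)..s, _ = 0
    rw [this, sub_self]
  have hGd : ContDiffAt ℝ ∞ G (x, γ) := hG.contDiffAt
  -- The partial derivative of `G` in the curve variable is the identity minus a Volterra operator.
  have hinv : (fderiv ℝ G (x, γ) ∘L .inr ℝ E C(unitInterval, E)).IsInvertible := by
    have h1 : HasFDerivAt (fun γ' => G (x, γ')) (fderiv ℝ G (x, γ) ∘L .inr ℝ E _) γ :=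
      (hGd.differentiableAt (by simp)).hasFDerivAt.comp γ (hasFDerivAt_prodMk_right x γ)
    have h2 : HasFDerivAt (fun γ' => G (x, γ')) (1 - volterra (superposition unitInterval X' γ))
        γ := by
      refine ((hasFDerivAt_id γ).sub_const (const x)).sub
        ((integration E).hasFDerivAt.comp γ (hasFDerivAt_superposition Xc X' (fun y => ?_) γ))
      exact (hX1.differentiable one_ne_zero y).hasFDerivAt
    rw [h1.unique h2]
    obtain ⟨u, hu⟩ := isUnit_one_sub_volterra (superposition unitInterval X' γ)
    exact ⟨ContinuousLinearEquiv.ofUnit u, hu⟩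
  have hne : (∞ : WithTop ℕ∞) ≠ 0 := by simp
  have hev := hGd.eventually_apply_implicitFunction hne hinv
  have hcd := hGd.contDiffAt_implicitFunction hne hinv
  refine ((ContinuousMap.evalCLM ℝ (1 : unitInterval)).contDiff.contDiffAt.comp x
    hcd).congr_of_eventuallyEq ?_
  filter_upwards [hev] with y hy
  exact (key y _ (hy.trans hGγ) 1).symm

end Flow

/-! ### Bounded polynomials on affine varieties -/

section BoundedValues

/-- Inverses of the translates of a transcendental element are linearly independent. -/
lemma linearIndependent_inv_sub_of_transcendental {K A ι : Type*} [Field K] [CommRing A]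
    [Algebra K A] {a : A} (ha : Transcendental K a) {c : ι → K} (hc : Function.Injective c)
    {u : ι → A} (hu : ∀ i, (a - algebraMap K A (c i)) * u i = 1) : LinearIndependent K u := by
  classical
  rw [linearIndependent_iff']
  intro s w hw i hi
  -- This is the linear relation with denominators cleared. At `c i` only the `i`-th term survives,
  -- and its product is nonzero.
  let Q : Polynomial K := ∑ j ∈ s, Polynomial.C (w j) *
    ∏ k ∈ s.erase j, (Polynomial.X - Polynomial.C (c k))
  have hQ : Polynomial.aeval a Q = 0 := by
    have : Polynomial.aeval a Q =
        (∏ k ∈ s, (a - algebraMap K A (c k))) * ∑ j ∈ s, w j • u j := by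
      rw [map_sum, Finset.mul_sum]
      refine Finset.sum_congr rfl fun j hj => ?_
      rw [← Finset.mul_prod_erase s _ hj, map_mul, map_prod]
      simp only [map_sub, Polynomial.aeval_C, Polynomial.aeval_X, Algebra.smul_def]
      linear_combination (-(algebraMap K A (w j)) *
        ∏ k ∈ s.erase j, (a - algebraMap K A (c k))) * hu j
    rw [this, hw, mul_zero]
  have hQ0 : Q = 0 := (transcendental_iff.1 ha) Q hQ
  have hev := congrArg (Polynomial.eval (c i)) hQ0
  simp only [Q, Polynomial.eval_finsetSum, Polynomial.eval_mul, Polynomial.eval_C,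
    Polynomial.eval_prod, Polynomial.eval_sub, Polynomial.eval_X, Polynomial.eval_zero] at hev
  rw [Finset.sum_eq_single i] at hev
  · refine (mul_eq_zero.1 hev).resolve_right (Finset.prod_ne_zero_iff.2 fun k hk => ?_)
    exact sub_ne_zero.2 fun h => (Finset.mem_erase.1 hk).1 (hc h).symm
  · intro j _ hji
    rw [Finset.prod_eq_zero (Finset.mem_erase.2 ⟨hji.symm, hi⟩) (sub_self _), mul_zero]
  · exact fun h => absurd hi h

/-- A polynomial that is bounded on an affine variety takes finitely many values on it. -/
lemma finite_image_of_bounded {σ : Type} [Finite σ] (J : Set (MvPolynomial σ ℂ))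
    (f : MvPolynomial σ ℂ) (M : ℝ)
    (h : ∀ x, (∀ p ∈ J, eval x p = 0) → ‖eval x f‖ ≤ M) :
    ((fun x => eval x f) '' {x | ∀ p ∈ J, eval x p = 0}).Finite := by
  let a : MvPolynomial σ ℂ ⧸ Ideal.span J := Ideal.Quotient.mk _ f
  -- For `r > M` the polynomial `f - r` has no zero on the variety, so by the Nullstellensatz it is
  -- a unit modulo `J`.
  have hunit : ∀ r : Ioi M, ∃ u, (a - algebraMap ℂ _ ((r : ℝ) : ℂ)) * u = 1 := by
    intro r
    have htop : Ideal.span (insert (f - C ((r : ℝ) : ℂ)) J) = ⊤ := by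
      rw [← Ideal.radical_eq_top, ← vanishingIdeal_zeroLocus_eq_radical (K := ℂ),
        zeroLocus_span]
      convert vanishingIdeal_empty (k := ℂ) (K := ℂ) (σ := σ)
      rw [eq_empty_iff_forall_notMem]
      intro x hx
      have h1 := h x fun p hp => by simpa [aeval_eq_eval] using hx p (mem_insert_of_mem _ hp)
      have h2 := hx _ (mem_insert _ _)
      simp only [aeval_eq_eval, map_sub, eval_C, sub_eq_zero] at h2
      rw [h2, Complex.norm_real] at h1
      exact absurd ((le_abs_self _).trans h1) (not_le.2 r.2)
    have h1 : (1 : MvPolynomial σ ℂ) ∈ Ideal.span (insert (f - C ((r : ℝ) : ℂ)) J) := by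
      rw [htop]; trivial
    obtain ⟨u, z, hz, hu⟩ := Ideal.mem_span_insert.1 h1
    refine ⟨Ideal.Quotient.mk _ u, ?_⟩
    have := congrArg (Ideal.Quotient.mk (Ideal.span J)) hu
    rw [map_add, Ideal.Quotient.eq_zero_iff_mem.2 hz, add_zero, map_one, map_mul, map_sub] at this
    rw [mul_comm]
    exact this.symm
  choose u hu using hunit
  -- Otherwise the inverses of `a - r` would be continuum many independent vectors in a space of
  -- countable dimension.
  have halg : IsAlgebraic ℂ a := by
    by_contra ha
    have hli := linearIndependent_inv_sub_of_transcendental (c := fun r : Ioi M => ((r : ℝ) : ℂ))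
      ha (fun r s hrs => Subtype.ext (Complex.ofReal_injective hrs)) hu
    have h1 := hli.cardinal_le_rank
    have h2 : Module.rank ℂ (MvPolynomial σ ℂ ⧸ Ideal.span J) ≤ Cardinal.aleph0 := by
      refine (rank_quotient_le ((Ideal.span J).restrictScalars ℂ)).trans ?_
      rw [MvPolynomial.rank_eq]
      exact Cardinal.mk_le_aleph0
    rw [Cardinal.mk_Ioi_real] at h1
    exact absurd (h1.trans h2) (not_le.2 Cardinal.aleph0_lt_continuum)
  obtain ⟨p, hp0, hp⟩ := halg
  refine (p.roots.toFinset.finite_toSet).subset ?_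
  rintro _ ⟨x, hx, rfl⟩
  simp only [Finset.mem_coe, Multiset.mem_toFinset, Polynomial.mem_roots hp0, Polynomial.IsRoot.def]
  have hmem : Polynomial.aeval f p ∈ Ideal.span J := by
    rw [← Ideal.Quotient.eq_zero_iff_mem, ← hp]
    exact (Polynomial.aeval_algHom_apply (Ideal.Quotient.mkₐ ℂ (Ideal.span J)) f p).symm
  have hle : Ideal.span J ≤ RingHom.ker (eval x) := Ideal.span_le.2 hx
  have := hle hmem
  rw [RingHom.mem_ker, ← coe_aeval_eq_eval] at this
  have h3 := (Polynomial.aeval_algHom_apply (aeval x) f p).symm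
  simpa using h3.symm.trans this
end BoundedValues

/-! ### Polynomial differentials and finiteness of the critical values -/

section Polynomial

variable {N : ℕ}

@[simp] lemma ev_C (a : ℂ) (z : Aff N) : ev (C a) z = a := by simp [ev]

@[simp] lemma ev_X (i : Fin N) (z : Aff N) : ev (X i) z = z i := by simp [ev]

@[simp] lemma ev_zero (z : Aff N) : ev (0 : MvPolynomial (Fin N) ℂ) z = 0 := map_zero _

@[simp] lemma ev_add (p q : MvPolynomial (Fin N) ℂ) (z : Aff N) :
    ev (p + q) z = ev p z + ev q z := map_add _ _ _

@[simp] lemma ev_mul (p q : MvPolynomial (Fin N) ℂ) (z : Aff N) :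
    ev (p * q) z = ev p z * ev q z := map_mul _ _ _

lemma differential_apply (p : MvPolynomial (Fin N) ℂ) (z v : Aff N) :
    differential p z v = ∑ i, ev (pderiv i p) z * v i := by
  simp [differential]

@[simp] lemma differential_add (p q : MvPolynomial (Fin N) ℂ) (z : Aff N) :
    differential (p + q) z = differential p z + differential q z := by
  ext v
  simp [differential_apply, add_mul, Finset.sum_add_distrib]

@[simp] lemma differential_mul (p q : MvPolynomial (Fin N) ℂ) (z : Aff N) :
    differential (p * q) z = ev p z • differential q z + ev q z • differential p z := by
  ext v
  simp [differential_apply, add_mul, Finset.sum_add_distrib, Finset.mul_sum, mul_assoc]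

@[simp] lemma differential_C (a : ℂ) (z : Aff N) :
    differential (C a : MvPolynomial (Fin N) ℂ) z = 0 := by
  ext v
  simp [differential_apply]

@[simp] lemma differential_X (i : Fin N) (z : Aff N) :
    differential (X i : MvPolynomial (Fin N) ℂ) z = EuclideanSpace.proj i := by
  ext v
  have h : ∀ j, ev (pderiv j (X i : MvPolynomial (Fin N) ℂ)) z = if j = i then 1 else 0 := by
    intro j
    simp [ev, pderiv_X, Pi.single_apply, eq_comm]
  simp only [differential_apply, h, ite_mul, one_mul, zero_mul, Finset.sum_ite_eq',
    Finset.mem_univ, if_true, PiLp.proj_apply]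

lemma hasFDerivAt_ev (p : MvPolynomial (Fin N) ℂ) (z : Aff N) :
    HasFDerivAt (ev p) (differential p z) z := by
  induction p using MvPolynomial.induction_on with
  | C a =>
    rw [differential_C, show ev (C a : MvPolynomial (Fin N) ℂ) = fun _ => a from funext (ev_C a)]
    exact hasFDerivAt_const _ _
  | add p q hp hq =>
    rw [differential_add, show ev (p + q) = fun z => ev p z + ev q z from funext (ev_add p q)]
    exact hp.add hq
  | mul_X p i hp =>
    have h : ev (p * X i) = fun z => ev p z * (EuclideanSpace.proj i : Aff N →L[ℂ] ℂ) z := by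
      ext; simp
    have h' := hp.mul (ContinuousLinearMap.hasFDerivAt (EuclideanSpace.proj i : Aff N →L[ℂ] ℂ))
    rw [h, differential_mul, differential_X, ev_X]
    exact h'

lemma contDiff_ev_complex (p : MvPolynomial (Fin N) ℂ) : ContDiff ℂ ∞ (ev p) := by
  induction p using MvPolynomial.induction_on with
  | C a =>
    rw [show ev (C a : MvPolynomial (Fin N) ℂ) = fun _ => a from funext (ev_C a)]
    exact contDiff_const
  | add p q hp hq =>
    rw [show ev (p + q) = fun z => ev p z + ev q z from funext (ev_add p q)]
    exact hp.add hq
  | mul_X p i hp =>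
    have h : ev (p * X i) = fun z => ev p z *
        (EuclideanSpace.proj i : Aff N →L[ℂ] ℂ) z := by
      ext; simp
    rw [h]
    exact hp.mul (ContinuousLinearMap.contDiff _)

lemma contDiff_ev (p : MvPolynomial (Fin N) ℂ) : ContDiff ℝ ∞ (ev p) :=
  (contDiff_ev_complex p).restrict_scalars ℝ

lemma continuous_ev (p : MvPolynomial (Fin N) ℂ) : Continuous (ev p) := (contDiff_ev p).continuous

lemma contDiff_differential (p : MvPolynomial (Fin N) ℂ) : ContDiff ℂ ∞ (differential p) := by
  unfold differential
  exact ContDiff.sum fun i _ => (contDiff_ev_complex _).smul contDiff_const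

lemma IsAffineSubvariety.isClosed {S : Set (Aff N)} (hS : IsAffineSubvariety S) : IsClosed S := by
  obtain ⟨I, rfl⟩ := hS
  simp only [ofPred_forall]
  exact isClosed_iInter fun p => isClosed_iInter fun _ =>
    isClosed_eq (continuous_ev p) continuous_const

/-- The vanishing ideal of a set has finitely many generators, and their differentials define
the tangent spaces. -/
lemma exists_generators (S : Set (Aff N)) : ∃ (m : ℕ) (q : Fin m → MvPolynomial (Fin N) ℂ),
    (∀ j, q j ∈ vanishingPolys S) ∧ ∀ z, (∀ j, ev (q j) z = 0) →
      (∀ p ∈ vanishingPolys S, ev p z = 0) ∧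
      ∀ v, (∀ j, differential (q j) z v = 0) → v ∈ tangentSpace S z := by
  let I : Ideal (MvPolynomial (Fin N) ℂ) :=
    { carrier := vanishingPolys S
      zero_mem' := fun z _ => ev_zero z
      add_mem' := fun {p q} hp hq z hz => by rw [ev_add, hp z hz, hq z hz, add_zero]
      smul_mem' := fun c p hp z hz => by rw [smul_eq_mul, ev_mul, hp z hz, mul_zero] }
  obtain ⟨m, q, hq⟩ := Submodule.fg_iff_exists_fin_generating_family.1
    (IsNoetherian.noetherian I)
  have hspan : ∀ p ∈ vanishingPolys S,
      p ∈ Submodule.span (MvPolynomial (Fin N) ℂ) (range q) := fun p hp => by rw [hq]; exact hp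
  refine ⟨m, q, fun j => ?_, fun z hz => ?_⟩
  · have : q j ∈ I := hq ▸ Submodule.subset_span (mem_range_self j)
    exact this
  have hev : ∀ p ∈ Submodule.span (MvPolynomial (Fin N) ℂ) (range q), ev p z = 0 := by
    intro p hp
    induction hp using Submodule.span_induction with
    | mem x hx => obtain ⟨j, rfl⟩ := hx; exact hz j
    | zero => simp
    | add x y _ _ hx hy => simp [hx, hy]
    | smul a x _ hx => simp [hx]
  refine ⟨fun p hp => hev p (hspan p hp), fun v hv p hp => ?_⟩
  have hp' := hspan p hp
  clear hp
  induction hp' using Submodule.span_induction with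
  | mem x hx => obtain ⟨j, rfl⟩ := hx; exact hv j
  | zero => rw [← C_0, differential_C, zero_apply]
  | add x y _ _ hx hy => simp [hx, hy]
  | smul a x hx' hx => simp [hx, hev x hx']

lemma dRestrict_eq_zero_iff {S : Set (Aff N)} {f : MvPolynomial (Fin N) ℂ} {z : Aff N} :
    dRestrict S f z = 0 ↔ ∀ v ∈ tangentSpace S z, differential f z v = 0 := by
  rw [ContinuousLinearMap.ext_iff]
  exact Subtype.forall

lemma re_inner_gradRe (S : Set (Aff N)) (f : MvPolynomial (Fin N) ℂ) (z : Aff N)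
    (v : tangentSpace S z) : (inner ℂ (gradRe S f z) v).re = (dRestrict S f z v).re := by
  let : InnerProductSpace ℝ (tangentSpace S z) := InnerProductSpace.complexToReal
  let : CompleteSpace (tangentSpace S z) := FiniteDimensional.complete ℂ _
  exact InnerProductSpace.toDual_symm_apply (𝕜 := ℝ) (x := v) (y := dRe S f z)

lemma re_dRestrict_gradRe (S : Set (Aff N)) (f : MvPolynomial (Fin N) ℂ) (z : Aff N) :
    (dRestrict S f z (gradRe S f z)).re = ‖gradRe S f z‖ ^ 2 := by
  rw [← re_inner_gradRe]
  exact inner_self_eq_norm_sq (𝕜 := ℂ) (gradRe S f z)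

lemma gradRe_eq_zero {S : Set (Aff N)} {f : MvPolynomial (Fin N) ℂ} {z : Aff N}
    (h : dRestrict S f z = 0) : gradRe S f z = 0 := by
  have := re_dRestrict_gradRe S f z
  rw [h] at this
  simpa using this.symm

/-- A map that is tame at infinity has finitely many critical values. -/
theorem finite_criticalValues {S : Set (Aff N)} (hS : IsAffineSubvariety S)
    {f : MvPolynomial (Fin N) ℂ} (htame : IsTameAtInfinity S f) :
    (criticalValues S f).Finite := by
  obtain ⟨m, q, hqS, hq⟩ := exists_generators S
  obtain ⟨R, -, ε, hε, hR⟩ := htame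
  obtain ⟨M, hM⟩ := (isCompact_closedBall (0 : Aff N) R).exists_bound_of_continuousOn
    (continuous_ev f).continuousOn
  have hcrit : ∀ z ∈ criticalPoints S f, ‖ev f z‖ ≤ M := by
    intro z hz
    refine hM z ?_
    rw [mem_closedBall_zero_iff]
    by_contra hlt
    have : z ∈ {z | z ∈ S ∧ ‖gradRe S f z‖ < ε ∧ R < ‖z‖} :=
      ⟨hz.1, by rw [gradRe_eq_zero hz.2, norm_zero]; exact hε, not_le.1 hlt⟩
    rw [hR] at this
    exact this
  have hzS : ∀ z : Aff N, (∀ j, ev (q j) z = 0) → z ∈ S := by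
    obtain ⟨I, rfl⟩ := hS
    exact fun z hz p hp => (hq z hz).1 p fun w hw => hw p hp
  let ι : MvPolynomial (Fin N) ℂ → MvPolynomial (Fin N ⊕ Fin m) ℂ := rename Sum.inl
  -- The Lagrange multiplier equations: `q j = 0` and `df = ∑ j, λ j • dq j`, with the multipliers
  -- `λ` in the `Sum.inr` variables. The bound on `f` involves only `z`, so unbounded multipliers do
  -- no harm.
  let J : Set (MvPolynomial (Fin N ⊕ Fin m) ℂ) := range (fun j => ι (q j)) ∪
    range (fun i => ι (pderiv i f) - ∑ j, X (Sum.inr j) * ι (pderiv i (q j)))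
  have hι : ∀ p x, eval x (ι p) = ev p (WithLp.toLp 2 (x ∘ Sum.inl)) := fun p x => by
    simp [ι, ev, eval_rename, Function.comp_def]
  have hJ : ∀ x, (∀ p ∈ J, eval x p = 0) → WithLp.toLp 2 (x ∘ Sum.inl) ∈ criticalPoints S f := by
    intro x hx
    set z : Aff N := WithLp.toLp 2 (x ∘ Sum.inl) with hz
    have h1 : z ∈ S := hzS _ fun j => by rw [← hι]; exact hx _ (Or.inl ⟨j, rfl⟩)
    refine ⟨h1, dRestrict_eq_zero_iff.2 fun v hv => ?_⟩
    have h2 : differential f z = ∑ j, x (Sum.inr j) • differential (q j) z := by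
      have : ∀ i, ev (pderiv i f) z = ∑ j, x (Sum.inr j) * ev (pderiv i (q j)) z := by
        intro i
        have := hx _ (Or.inr ⟨i, rfl⟩)
        simpa [hι, sub_eq_zero, ← hz] using this
      ext v
      simp only [differential_apply, this, sum_apply, smul_apply,
        smul_eq_mul, Finset.sum_mul, Finset.mul_sum, mul_assoc]
      exact Finset.sum_comm
    simp only [h2, sum_apply, smul_apply, hv _ (hqS _), smul_zero,
      Finset.sum_const_zero]
  refine (finite_image_of_bounded J (ι f) M fun x hx => ?_).subset ?_
  · rw [hι]
    exact hcrit _ (hJ x hx)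
  · rintro _ ⟨z, hz, rfl⟩
    -- Multipliers exist because `df` vanishes on the common kernel of the `dq j`.
    have hspan : (differential f z : Aff N →ₗ[ℂ] ℂ) ∈
        Submodule.span ℂ (range fun j => (differential (q j) z : Aff N →ₗ[ℂ] ℂ)) := by
      apply mem_span_of_iInf_ker_le_ker
      intro v hv
      simp only [Submodule.mem_iInf, LinearMap.mem_ker] at hv
      exact dRestrict_eq_zero_iff.1 hz.2 v ((hq z fun j => hqS j z hz.1).2 v hv)
    obtain ⟨l, hl⟩ := (Submodule.mem_span_range_iff_exists_fun ℂ).1 hspan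
    refine ⟨Sum.elim (fun i => z i) l, ?_, ?_⟩
    · rintro p (⟨j, rfl⟩ | ⟨i, rfl⟩)
      · simp only [hι, Sum.elim_comp_inl]
        exact hqS j z hz.1
      · have hs : ∀ p : MvPolynomial (Fin N) ℂ,
            differential p z (EuclideanSpace.single i 1) = ev (pderiv i p) z := fun p => by
          simp [differential_apply]
        have := LinearMap.congr_fun hl (EuclideanSpace.single i 1)
        simp only [LinearMap.coe_sum, Finset.sum_apply, LinearMap.smul_apply,
          ContinuousLinearMap.coe_coe, hs, smul_eq_mul] at this
        simp [hι, Sum.elim_comp_inl, ← this]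
    · simp only [hι, Sum.elim_comp_inl]
end Polynomial

/-! ### Tangent projections and bounded lifts of the unit vector -/

section LocalGeometry

variable {N : ℕ} {S : Set (Aff N)} {f : MvPolynomial (Fin N) ℂ}

lemma hasDerivAt_ev_comp (p : MvPolynomial (Fin N) ℂ) {γ : ℝ → Aff N} {v : Aff N} {s : ℝ}
    (h : HasDerivAt γ v s) : HasDerivAt (fun s => ev p (γ s)) (differential p (γ s) v) s :=
  ((hasFDerivAt_ev p (γ s)).restrictScalars ℝ).comp_hasDerivAt s h

lemma contDiffOn_clm_apply {E F G : Type*} [NormedAddCommGroup E] [NormedSpace ℝ E]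
    [NormedAddCommGroup F] [NormedSpace ℂ F] [NormedAddCommGroup G] [NormedSpace ℂ G]
    {n : WithTop ℕ∞} {A : E → F →L[ℂ] G} {w : E → F} {U : Set E}
    (hA : ContDiffOn ℝ n A U) (hw : ContDiffOn ℝ n w U) :
    ContDiffOn ℝ n (fun y => A y (w y)) U :=
  ((ContinuousLinearMap.restrictScalarsL ℂ F G ℝ ℝ).contDiff.comp_contDiffOn hA).clm_apply hw

lemma exists_local_integralCurve {E : Type*} [NormedAddCommGroup E] [NormedSpace ℝ E]
    [CompleteSpace E] {u : E → E} {y : E} (hu : ContDiffAt ℝ 1 u y) {U : Set E} (hU : U ∈ 𝓝 y) :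
    ∃ γ : ℝ → E, γ 0 = y ∧ ∃ δ > (0 : ℝ), ∀ s ∈ Ioo (-δ) δ,
      γ s ∈ U ∧ HasDerivAt γ (u (γ s)) s := by
  obtain ⟨γ, h0, ε, hε, hγ⟩ :=
    hu.exists_forall_mem_closedBall_exists_eq_forall_mem_Ioo_hasDerivAt₀ 0
  have hc : ContinuousAt γ 0 := (hγ 0 (by simpa using hε)).continuousAt
  obtain ⟨δ, hδ, hδU⟩ := Metric.mem_nhds_iff.1 (hc (by rw [h0]; exact hU))
  refine ⟨γ, h0, min δ ε, lt_min hδ hε, fun s hs => ⟨hδU ?_, hγ s ?_⟩⟩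
  · rw [Real.ball_eq_Ioo, zero_sub, zero_add]
    exact ⟨by linarith [hs.1, min_le_left δ ε], hs.2.trans_le (min_le_left _ _)⟩
  · rw [zero_sub, zero_add]
    exact ⟨by linarith [hs.1, min_le_right δ ε], hs.2.trans_le (min_le_right _ _)⟩

/-- A proper range would lie in the kernel of a nonzero functional on `ℂ^k`, whose coefficients give
a linear relation among the `φ i`. -/
lemma surjective_pi_of_linearIndependent {E : Type*} [NormedAddCommGroup E] [NormedSpace ℂ E]
    {k : ℕ} {φ : Fin k → E →L[ℂ] ℂ} (h : LinearIndependent ℂ φ) :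
    Function.Surjective (ContinuousLinearMap.pi φ) := by
  by_contra hns
  have hlt : LinearMap.range (ContinuousLinearMap.pi φ : E →ₗ[ℂ] Fin k → ℂ) < ⊤ :=
    lt_top_iff_ne_top.2 fun h => hns (LinearMap.range_eq_top.1 h)
  obtain ⟨l, hl0, hl⟩ := Submodule.exists_le_ker_of_lt_top _ hlt
  apply hl0
  have hlx : ∀ x, l x = ∑ i, x i * l (Pi.single i 1) := fun x => by
    conv_lhs => rw [pi_eq_sum_univ' x]
    simp [map_sum]
  have hz : ∀ i, l (Pi.single i 1) = 0 := by
    refine Fintype.linearIndependent_iff.1 h _ ?_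
    ext v
    have := hl (LinearMap.mem_range_self _ v)
    rw [LinearMap.mem_ker, hlx] at this
    simpa [sum_apply, mul_comm] using this
  ext i
  simpa using hz i

/-- Near a point of a smooth variety there is a smooth family of projections onto the tangent
spaces whose integral curves do not leave the variety. -/
lemma IsSmoothAt.exists_tangentProjection {z : Aff N} (hz : IsSmoothAt S z) :
    ∃ (U : Set (Aff N)) (π : Aff N → Aff N →L[ℂ] Aff N), IsOpen U ∧ z ∈ U ∧
      ContDiffOn ℝ ∞ π U ∧
      (∀ y ∈ U ∩ S, ∀ v ∈ tangentSpace S y, π y v = v) ∧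
      (∀ y ∈ U ∩ S, ∀ v, π y v ∈ tangentSpace S y) ∧
      ∀ (γ : ℝ → Aff N) (δ : ℝ), γ 0 ∈ S →
        (∀ s ∈ Ioo (-δ) δ, γ s ∈ U ∧ ∃ v, HasDerivAt γ (π (γ s) v) s) →
        ∀ s ∈ Ioo (-δ) δ, γ s ∈ S := by
  obtain ⟨k, p, hp, hli, W, hW, hzW, hWS⟩ := hz
  let A : Aff N → Aff N →L[ℂ] (Fin k → ℂ) := fun y =>
    ContinuousLinearMap.pi fun i => differential (p i) y
  have hA : ContDiff ℂ ∞ A := by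
    have h : A = fun y => ∑ i, (ContinuousLinearMap.single ℂ (fun _ : Fin k => ℂ) i).comp
        (differential (p i) y) := by
      ext y v i
      simp [A, sum_apply, Pi.single_apply]
    rw [h]
    exact ContDiff.sum fun i _ => contDiff_const.clm_comp (contDiff_differential (p i))
  have hsurj : Function.Surjective (A z) := surjective_pi_of_linearIndependent hli
  obtain ⟨B', hB'⟩ := (A z : Aff N →ₗ[ℂ] (Fin k → ℂ)).exists_rightInverse_of_surjective
    (LinearMap.range_eq_top.2 hsurj)
  let B : (Fin k → ℂ) →L[ℂ] Aff N := LinearMap.toContinuousLinearMap B'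
  let M : Aff N → (Fin k → ℂ) →L[ℂ] (Fin k → ℂ) := fun y => (A y).comp B
  have hM : ContDiff ℂ ∞ M := hA.clm_comp contDiff_const
  have hMz : M z = 1 := by
    ext1 v
    exact LinearMap.congr_fun hB' v
  -- Where `A y ∘ B` is invertible, this is the projection onto `ker (A y)` along the range of `B`.
  let π : Aff N → Aff N →L[ℂ] Aff N := fun y => 1 - B.comp ((Ring.inverse (M y)).comp (A y))
  let U : Set (Aff N) := W ∩ M ⁻¹' {m | IsUnit m}
  have hU : IsOpen U := hW.inter (Units.isOpen.preimage hM.continuous)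
  have hπ : ContDiffOn ℝ ∞ π U := by
    intro y hy
    obtain ⟨m, hm⟩ := hy.2
    have h1 : ContDiffAt ℂ ∞ (fun y => Ring.inverse (M y)) y := by
      refine ContDiffAt.comp (g := Ring.inverse) (f := M) y ?_ hM.contDiffAt
      rw [← hm]
      exact contDiffAt_ringInverse ℂ m
    have h2 : ContDiffAt ℂ ∞ π y :=
      contDiffAt_const.sub (contDiffAt_const.clm_comp (h1.clm_comp hA.contDiffAt))
    exact (h2.restrict_scalars ℝ).contDiffWithinAt
  have hAπ : ∀ y ∈ U, ∀ v, A y (π y v) = 0 := by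
    intro y hy v
    have h := DFunLike.congr_fun (Ring.mul_inverse_cancel (M y) hy.2) (A y v)
    simp only [π, sub_apply, map_sub]
    exact sub_eq_zero.2 h.symm
  have hπA : ∀ y v, A y v = 0 → π y v = v := by
    intro y v h
    simp [π, h]
  have hcurve : ∀ (γ : ℝ → Aff N) (δ : ℝ), γ 0 ∈ S →
      (∀ s ∈ Ioo (-δ) δ, γ s ∈ U ∧ ∃ v, HasDerivAt γ (π (γ s) v) s) →
      ∀ s ∈ Ioo (-δ) δ, γ s ∈ S := by
    intro γ δ h0 hγ s hs
    refine hWS _ (hγ s hs).1.1 fun i => ?_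
    have hd : ∀ t ∈ Ioo (-δ) δ, HasDerivAt (fun t => ev (p i) (γ t)) 0 t := by
      intro t ht
      obtain ⟨htU, v, hv⟩ := hγ t ht
      have := hasDerivAt_ev_comp (p i) hv
      rwa [show differential (p i) (γ t) (π (γ t) v) = 0 from congrFun (hAπ _ htU v) i] at this
    have h0' : (0 : ℝ) ∈ Ioo (-δ) δ := ⟨by linarith [hs.1, hs.2], by linarith [hs.1, hs.2]⟩
    rw [isOpen_Ioo.is_const_of_deriv_eq_zero isPreconnected_Ioo
      (fun t ht => (hd t ht).differentiableAt.differentiableWithinAt)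
      (fun t ht => (hd t ht).deriv) hs h0']
    exact hp i _ h0
  refine ⟨U, π, hU, ⟨hzW, by simp [hMz]⟩, hπ, ?_, ?_, hcurve⟩
  · intro y hy v hv
    exact hπA y v (funext fun i => hv (p i) (hp i))
  · intro y hy v q hq
    -- The kernel of the `dp i` is tangent to all of `S`: the integral curve of `π · v` through `y`
    -- stays in `S`, so every polynomial vanishing on `S` has derivative zero along it.
    have hu : ContDiffAt ℝ 1 (fun x => π x v) y :=
      ((contDiffOn_clm_apply hπ contDiffOn_const).contDiffAt (hU.mem_nhds hy.1)).of_le (by simp)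
    obtain ⟨γ, h0, δ, hδ, hγ⟩ := exists_local_integralCurve hu (hU.mem_nhds hy.1)
    have hγS := hcurve γ δ (h0 ▸ hy.2) fun s hs => ⟨(hγ s hs).1, v, (hγ s hs).2⟩
    have h0' : (0 : ℝ) ∈ Ioo (-δ) δ := ⟨by linarith, hδ⟩
    have hd := hasDerivAt_ev_comp q (hγ 0 h0').2
    have hc : (fun s => ev q (γ s)) =ᶠ[𝓝 0] fun _ => 0 := by
      filter_upwards [Ioo_mem_nhds h0'.1 h0'.2] with s hs
      exact hq _ (hγS s hs)
    have := hd.unique ((hasDerivAt_const (0 : ℝ) (0 : ℂ)).congr_of_eventuallyEq hc)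
    rwa [h0] at this

/-- A tangent vector lifting the unit vector of the target extends to a local lift. -/
lemma IsSmoothAt.exists_local_lift {z v : Aff N} (hz : IsSmoothAt S z) (hzS : z ∈ S)
    (hv : v ∈ tangentSpace S z) (hfv : differential f z v = 1) :
    ∃ (U : Set (Aff N)) (g : Aff N → Aff N), IsOpen U ∧ z ∈ U ∧ ContDiffOn ℝ ∞ g U ∧ g z = v ∧
      ∀ y ∈ U ∩ S, g y ∈ tangentSpace S y ∧ differential f y (g y) = 1 := by
  obtain ⟨U, π, hU, hzU, hπ, hid, htan, -⟩ := hz.exists_tangentProjection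
  have hπv : ContDiffOn ℝ ∞ (fun y => π y v) U :=
    contDiffOn_clm_apply hπ contDiffOn_const
  have hh : ContDiffOn ℝ ∞ (fun y => differential f y (π y v)) U :=
    contDiffOn_clm_apply ((contDiff_differential f).restrict_scalars ℝ).contDiffOn hπv
  have hzv : π z v = v := hid z ⟨hzU, hzS⟩ v hv
  -- Projecting the fixed vector `v` gives a tangent field on which `df` is nonzero near `z`;
  -- dividing by that value normalizes it to 1.
  refine ⟨U ∩ (fun y => differential f y (π y v)) ⁻¹' {0}ᶜ,
    fun y => (differential f y (π y v))⁻¹ • π y v,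
    hh.continuousOn.isOpen_inter_preimage hU isOpen_compl_singleton, ⟨hzU, ?_⟩, ?_, ?_, ?_⟩
  · simp [hzv, hfv]
  · exact ((hh.mono inter_subset_left).inv fun y hy => hy.2).smul (hπv.mono inter_subset_left)
  · simp [hzv, hfv]
  · intro y hy
    refine ⟨Submodule.smul_mem _ _ (htan y ⟨hy.1.1, hy.2⟩ v), ?_⟩
    rw [map_smul, smul_eq_mul, inv_mul_cancel₀ hy.1.2]

lemma exists_lift_of_gradRe_ne_zero {z : Aff N} (h : gradRe S f z ≠ 0) :
    ∃ v ∈ tangentSpace S z, differential f z v = 1 ∧ ‖v‖ ≤ ‖gradRe S f z‖⁻¹ := by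
  set a := gradRe S f z with ha
  have hn : 0 < ‖a‖ := norm_pos_iff.2 h
  set ζ := dRestrict S f z a with hζ
  have hre : ζ.re = ‖a‖ ^ 2 := re_dRestrict_gradRe S f z
  have hle : ‖a‖ ^ 2 ≤ ‖ζ‖ := hre ▸ Complex.re_le_norm ζ
  have hζ0 : ζ ≠ 0 := norm_pos_iff.1 (lt_of_lt_of_le (by positivity) hle)
  refine ⟨ζ⁻¹ • (a : Aff N), Submodule.smul_mem _ _ a.2, ?_, ?_⟩
  · rw [map_smul, smul_eq_mul]
    exact inv_mul_cancel₀ hζ0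
  · rw [norm_smul, norm_inv, ← Submodule.coe_norm, inv_mul_le_iff₀ (norm_pos_iff.2 hζ0)]
    calc ‖a‖ = ‖a‖ ^ 2 * ‖a‖⁻¹ := by field_simp
      _ ≤ ‖ζ‖ * ‖a‖⁻¹ := by gcongr

lemma exists_lift_of_dRestrict_ne_zero {z : Aff N} (h : dRestrict S f z ≠ 0) :
    ∃ v ∈ tangentSpace S z, differential f z v = 1 := by
  rw [Ne, dRestrict_eq_zero_iff] at h
  push Not at h
  obtain ⟨v, hv, hne⟩ := h
  exact ⟨(differential f z v)⁻¹ • v, Submodule.smul_mem _ _ hv, by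
    rw [map_smul, smul_eq_mul, inv_mul_cancel₀ hne]⟩

/-- Local lifts are bounded near each point, hence uniformly on the compact part in the ball of
radius `R`. Beyond it, rescaled gradients have norm at most `ε⁻¹`. -/
lemma exists_bounded_lift (hS : IsSmoothAffineSubvariety S) (htame : IsTameAtInfinity S f)
    {K : Set (Aff N)} (hK : IsClosed K) (hKS : K ⊆ S) (hcrit : ∀ z ∈ K, dRestrict S f z ≠ 0) :
    ∃ M, ∀ z ∈ K, ∃ v ∈ tangentSpace S z, differential f z v = 1 ∧ ‖v‖ ≤ M := by
  obtain ⟨R, -, ε, hε, hR⟩ := htame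
  have hin : ∃ M, ∀ z ∈ K ∩ Metric.closedBall 0 R,
      ∃ v ∈ tangentSpace S z, differential f z v = 1 ∧ ‖v‖ ≤ M := by
    have hcpt : IsCompact (K ∩ Metric.closedBall 0 R) := (isCompact_closedBall 0 R).inter_left hK
    refine hcpt.induction_on
      (p := fun s => ∃ M, ∀ z ∈ s, ∃ v ∈ tangentSpace S z, differential f z v = 1 ∧ ‖v‖ ≤ M)
      ⟨0, fun z hz => hz.elim⟩ (fun s t hst ⟨M, hM⟩ => ⟨M, fun z hz => hM z (hst hz)⟩) ?_ ?_
    · rintro s t ⟨M₁, h₁⟩ ⟨M₂, h₂⟩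
      refine ⟨max M₁ M₂, fun z hz => ?_⟩
      rcases hz with hz | hz
      · obtain ⟨v, hv, hfv, hn⟩ := h₁ z hz
        exact ⟨v, hv, hfv, hn.trans (le_max_left _ _)⟩
      · obtain ⟨v, hv, hfv, hn⟩ := h₂ z hz
        exact ⟨v, hv, hfv, hn.trans (le_max_right _ _)⟩
    · intro z hz
      obtain ⟨v, hv, hfv⟩ := exists_lift_of_dRestrict_ne_zero (hcrit z hz.1)
      obtain ⟨U, g, hU, hzU, hg, hgz, hgy⟩ :=
        (hS.2 z (hKS hz.1)).exists_local_lift (hKS hz.1) hv hfv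
      have hb : ∀ᶠ y in 𝓝 z, ‖g y‖ < ‖v‖ + 1 :=
        (hg.continuousOn.continuousAt (hU.mem_nhds hzU)).norm.eventually_lt_const
          (by simp only [hgz]; linarith)
      refine ⟨{y | (y ∈ U ∧ ‖g y‖ < ‖v‖ + 1) ∧ y ∈ K}, ?_, ‖v‖ + 1, fun y hy => ?_⟩
      · filter_upwards [mem_nhdsWithin_of_mem_nhds (hU.mem_nhds hzU),
          mem_nhdsWithin_of_mem_nhds hb, self_mem_nhdsWithin] with y h1 h2 h3
        exact ⟨⟨h1, h2⟩, h3.1⟩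
      · obtain ⟨h1, h2⟩ := hgy y ⟨hy.1.1, hKS hy.2⟩
        exact ⟨g y, h1, h2, hy.1.2.le⟩
  obtain ⟨M, hM⟩ := hin
  refine ⟨max M ε⁻¹, fun z hz => ?_⟩
  by_cases hzR : ‖z‖ ≤ R
  · obtain ⟨v, hv, hfv, hn⟩ := hM z ⟨hz, mem_closedBall_zero_iff.2 hzR⟩
    exact ⟨v, hv, hfv, hn.trans (le_max_left _ _)⟩
  · have hge : ε ≤ ‖gradRe S f z‖ := by
      by_contra hlt
      have : z ∈ {z | z ∈ S ∧ ‖gradRe S f z‖ < ε ∧ R < ‖z‖} :=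
        ⟨hKS hz, not_le.1 hlt, not_le.1 hzR⟩
      rw [hR] at this
      exact this
    have hne : gradRe S f z ≠ 0 := norm_pos_iff.1 (lt_of_lt_of_le hε hge)
    obtain ⟨v, hv, hfv, hn⟩ := exists_lift_of_gradRe_ne_zero hne
    exact ⟨v, hv, hfv, hn.trans ((inv_anti₀ hε hge).trans (le_max_right _ _))⟩

/-- Over a closed set without critical points, the unit vector of the target lifts to a bounded
smooth vector field that is tangent to the variety. -/
lemma exists_lift_field (hS : IsSmoothAffineSubvariety S) (htame : IsTameAtInfinity S f)
    {K : Set (Aff N)} (hK : IsClosed K) (hKS : K ⊆ S) (hcrit : ∀ z ∈ K, dRestrict S f z ≠ 0) :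
    ∃ w : Aff N → Aff N, ContDiff ℝ ∞ w ∧ (∃ M, ∀ z, ‖w z‖ ≤ M) ∧
      ∀ z ∈ K, w z ∈ tangentSpace S z ∧ differential f z (w z) = 1 := by
  obtain ⟨M, hM⟩ := exists_bounded_lift hS htame hK hKS hcrit
  -- The conditions are convex, so local choices can be averaged. The `+ 1` leaves room for a local
  -- lift to exceed `M` away from its base point; `max M 0` keeps the zero field admissible off `K`.
  let t : Aff N → Set (Aff N) := fun z =>
    Metric.closedBall 0 (max M 0 + 1) ∩ {v | z ∈ K → v ∈ tangentSpace S z ∧ differential f z v = 1}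
  have ht : ∀ z, Convex ℝ (t z) := by
    refine fun z => (convex_closedBall _ _).inter ?_
    intro v hv w hw a b _ _ hab hz
    obtain ⟨h1, h2⟩ := hv hz
    obtain ⟨h3, h4⟩ := hw hz
    rw [← Complex.coe_smul a, ← Complex.coe_smul b]
    refine ⟨Submodule.add_mem _ (Submodule.smul_mem _ _ h1) (Submodule.smul_mem _ _ h3), ?_⟩
    rw [map_add, map_smul, map_smul, h2, h4, smul_eq_mul, smul_eq_mul, mul_one, mul_one]
    exact_mod_cast hab
  obtain ⟨w, hw⟩ := exists_contMDiffMap_forall_mem_convex_of_local (n := (⊤ : ℕ∞))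
    (modelWithCornersSelf ℝ (Aff N)) ht fun z => by
      by_cases hz : z ∈ K
      · obtain ⟨v, hv, hfv, hn⟩ := hM z hz
        obtain ⟨U, g, hU, hzU, hg, hgz, hgy⟩ :=
          (hS.2 z (hKS hz)).exists_local_lift (hKS hz) hv hfv
        have hb : ∀ᶠ y in 𝓝 z, ‖g y‖ < max M 0 + 1 :=
          (hg.continuousOn.continuousAt (hU.mem_nhds hzU)).norm.eventually_lt_const
            (by simp only [hgz]; linarith [le_max_left M 0])
        refine ⟨U ∩ {y | ‖g y‖ < max M 0 + 1}, inter_mem (hU.mem_nhds hzU) hb, g,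
          (hg.mono inter_subset_left).contMDiffOn, fun y hy => ⟨?_, fun hyK => ?_⟩⟩
        · exact mem_closedBall_zero_iff.2 hy.2.le
        · exact hgy y ⟨hy.1, hKS hyK⟩
      · refine ⟨Kᶜ, hK.isOpen_compl.mem_nhds hz, fun _ => 0, contMDiffOn_const,
          fun y hy => ⟨?_, fun hyK => absurd hyK hy⟩⟩
        exact Metric.mem_closedBall_self (by positivity)
  exact ⟨w, w.contMDiff.contDiff, ⟨_, fun z => mem_closedBall_zero_iff.1 (hw z).1⟩,
    fun z hz => (hw z).2 hz⟩

end LocalGeometry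

/-! ### Transport along lifted segments and the two inclusions -/

section Triviality

variable {N : ℕ} {S : Set (Aff N)} {f : MvPolynomial (Fin N) ℂ}

/-- Integral curves of a field that lifts the unit vector over `O` stay in the variety and
project to straight lines, as long as these lines stay in `O`. -/
lemma mem_and_ev_eq_of_integralCurve (hS : IsSmoothAffineSubvariety S) {O : Set ℂ}
    (hO : IsOpen O) {w : Aff N → Aff N} (hwd : ContDiff ℝ ∞ w)
    (hw : ∀ z ∈ S, ev f z ∈ O → w z ∈ tangentSpace S z ∧ differential f z (w z) = 1)
    {c : ℂ} {η : ℝ → Aff N} (hη : ∀ t ∈ Icc (0 : ℝ) 1, HasDerivAt η (c • w (η t)) t)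
    (h0 : η 0 ∈ S) (hline : ∀ t ∈ Icc (0 : ℝ) 1, ev f (η 0) + t * c ∈ O) :
    ∀ t ∈ Icc (0 : ℝ) 1, η t ∈ S ∧ ev f (η t) = ev f (η 0) + t * c := by
  have hηc : ContinuousOn η (Icc 0 1) := fun t ht => (hη t ht).continuousAt.continuousWithinAt
  have hsub : Icc (0 : ℝ) 1 ⊆ {t | η t ∈ S ∧ ev f (η t) = ev f (η 0) + t * c} := by
    refine IsClosed.Icc_subset_of_forall_mem_nhdsWithin ?_ ⟨h0, by simp⟩ ?_
    · have h1 := hηc.preimage_isClosed_of_isClosed isClosed_Icc hS.1.isClosed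
      have h2 : ContinuousOn (fun t : ℝ => ev f (η t) - (ev f (η 0) + t * c)) (Icc 0 1) :=
        ((continuous_ev f).comp_continuousOn hηc).sub (by fun_prop)
      have h3 := h2.preimage_isClosed_of_isClosed isClosed_Icc (isClosed_singleton (x := 0))
      convert h1.inter h3 using 1
      ext t
      simp only [mem_inter_iff, mem_preimage, mem_singleton_iff, sub_eq_zero, mem_ofPred_eq]
      tauto
    · rintro t₀ ⟨⟨htS, htf⟩, ht₀⟩
      obtain ⟨U, π, hU, hzU, hπ, hid, -, hcurve⟩ := (hS.2 _ htS).exists_tangentProjection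
      have hU' : U ∩ ev f ⁻¹' O ∈ 𝓝 (η t₀) := by
        refine inter_mem (hU.mem_nhds hzU) ((hO.preimage (continuous_ev f)).mem_nhds ?_)
        rw [mem_preimage, htf]
        exact hline t₀ (Ico_subset_Icc_self ht₀)
      -- Since `w` is known to be tangent only at points of `S`, the projected field is integrated
      -- first: its curves stay in `S`, where it agrees with `c • w`. Uniqueness then identifies the
      -- curve with `η`.
      have hu : ContDiffAt ℝ 1 (fun y => c • π y (w y)) (η t₀) :=
        (((contDiffOn_clm_apply hπ hwd.contDiffOn).contDiffAt
          (hU.mem_nhds hzU)).const_smul c).of_le (by simp)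
      obtain ⟨γ, hγ0, δ, hδ, hγ⟩ := exists_local_integralCurve hu hU'
      have hγS := hcurve γ δ (hγ0 ▸ htS) fun s hs =>
        ⟨(hγ s hs).1.1, c • w (γ s), by rw [map_smul]; exact (hγ s hs).2⟩
      have hγw : ∀ s ∈ Ioo (-δ) δ, HasDerivAt γ (c • w (γ s)) s := by
        intro s hs
        have := (hγ s hs).2
        rwa [hid _ ⟨(hγ s hs).1.1, hγS s hs⟩ _ (hw _ (hγS s hs) (hγ s hs).1.2).1] at this
      have hγf : ∀ s ∈ Ioo (-δ) δ, ev f (γ s) = ev f (γ 0) + s * c := by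
        have hd : ∀ s ∈ Ioo (-δ) δ, HasDerivAt (fun s : ℝ => ev f (γ s) - s * c) 0 s := by
          intro s hs
          have h1 := hasDerivAt_ev_comp f (hγw s hs)
          rw [map_smul, (hw _ (hγS s hs) (hγ s hs).1.2).2, smul_eq_mul, mul_one] at h1
          have h2 := h1.sub ((Complex.ofRealCLM.hasDerivAt (x := s)).mul_const c)
          simp only [Complex.ofRealCLM_apply, Complex.ofReal_one, one_mul, sub_self] at h2
          exact h2
        intro s hs
        have := isOpen_Ioo.is_const_of_deriv_eq_zero isPreconnected_Ioo
          (fun t ht => (hd t ht).differentiableAt.differentiableWithinAt)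
          (fun t ht => (hd t ht).deriv) hs (show (0 : ℝ) ∈ Ioo (-δ) δ from ⟨by linarith, hδ⟩)
        simp only [Complex.ofReal_zero, zero_mul, sub_zero] at this
        rw [← this, sub_add_cancel]
      set b := min (t₀ + δ / 2) 1 with hb
      have hbt : t₀ < b := lt_min (by linarith) ht₀.2
      have hsh : ∀ t ∈ Icc t₀ b, t - t₀ ∈ Ioo (-δ) δ := fun t ht =>
        ⟨by linarith [ht.1], by linarith [ht.2, min_le_left (t₀ + δ / 2) 1]⟩
      have heq : EqOn η (fun t => γ (t - t₀)) (Icc t₀ b) := by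
        refine eqOn_of_hasDerivAt (X := fun z => c • w z)
          ((hwd.const_smul c).of_le (by simp))
          (fun t ht => hη t ⟨ht₀.1.trans ht.1, ht.2.trans (min_le_right _ _)⟩)
          (fun t ht => (hγw _ (hsh t ht)).comp_sub_const t t₀) ?_
        simp [hγ0]
      filter_upwards [Icc_mem_nhdsGT hbt] with t ht
      rw [heq ht]
      refine ⟨hγS _ (hsh t ht), ?_⟩
      simp only
      rw [hγf _ (hsh t ht), hγ0, htf]
      push_cast
      ring
  exact fun t ht => hsub ht

/-- The time-one maps of the complex multiples of a bounded smooth vector field. -/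
lemma exists_smooth_transport {w : Aff N → Aff N} (hw : ContDiff ℝ ∞ w)
    (hb : ∃ M, ∀ z, ‖w z‖ ≤ M) :
    ∃ T : Aff N × ℂ → Aff N, ContDiff ℝ ∞ T ∧ (∀ z c, T (T (z, c), -c) = z) ∧
      ∀ z c, ∃ η : ℝ → Aff N, η 0 = z ∧ η 1 = T (z, c) ∧
        ∀ t ∈ Icc (0 : ℝ) 1, HasDerivAt η (c • w (η t)) t := by
  obtain ⟨M, hM⟩ := hb
  have hX : ∀ c : ℂ, ContDiff ℝ 1 fun z => c • w z := fun c =>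
    (hw.const_smul c).of_le (by simp)
  have hex : ∀ p : Aff N × ℂ, ∃ γ : ℝ → Aff N, γ 0 = p.1 ∧
      ∀ t ∈ Icc (0 : ℝ) 1, HasDerivAt γ (p.2 • w (γ t)) t := fun p =>
    exists_integralCurve_of_bounded (hX p.2) (M := ‖p.2‖ * M)
      (fun z => by rw [norm_smul]; gcongr; exact hM z) p.1
  choose γ hγ0 hγ using hex
  -- Adjoining `c` to the state with zero velocity gives smoothness jointly in `(z, c)`.
  have hF : ContDiff ℝ ∞ fun p : Aff N × ℂ => (γ p 1, p.2) := by
    refine contDiff_timeOne (X := fun p : Aff N × ℂ => (p.2 • w p.1, (0 : ℂ)))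
      (F := fun p t => (γ p t, p.2))
      ((contDiff_snd.smul (hw.comp contDiff_fst)).prodMk contDiff_const)
      (fun p => by rw [hγ0]) fun p t ht => (hγ p t ht).prodMk (hasDerivAt_const t p.2)
  refine ⟨fun p => γ p 1, contDiff_fst.comp hF, fun z c => ?_,
    fun z c => ⟨γ (z, c), hγ0 _, rfl, hγ (z, c)⟩⟩
  have hrev : EqOn (γ (γ (z, c) 1, -c)) (fun t => γ (z, c) (1 - t)) (Icc 0 1) := by
    refine eqOn_of_hasDerivAt (hX (-c)) (hγ (γ (z, c) 1, -c)) (fun t ht => ?_) (by simp [hγ0])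
    have := (hγ (z, c) (1 - t) ⟨by linarith [ht.2], by linarith [ht.1]⟩).comp_const_sub 1 t
    simpa using this
  have := hrev (right_mem_Icc.2 zero_le_one)
  simpa [hγ0] using this

theorem isLocallyTrivialOff_criticalValues (hS : IsSmoothAffineSubvariety S)
    (htame : IsTameAtInfinity S f) : IsLocallyTrivialOff S f (criticalValues S f) := by
  intro τ hτ
  have hopen : IsOpen (criticalValues S f)ᶜ :=
    (finite_criticalValues hS.1 htame).isClosed.isOpen_compl
  -- The closed disc makes the set where the lift is prescribed closed; the trivialization uses the
  -- open disc, whose convexity contains the segments.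
  obtain ⟨r, hr, hrS⟩ := Metric.nhds_basis_closedBall.mem_iff.1 (hopen.mem_nhds hτ)
  have hK : IsClosed (S ∩ ev f ⁻¹' Metric.closedBall τ r) :=
    hS.1.isClosed.inter (Metric.isClosed_closedBall.preimage (continuous_ev f))
  obtain ⟨w, hwd, hwb, hw⟩ := exists_lift_field hS htame hK inter_subset_left
    fun z hz h => hrS hz.2 ⟨z, ⟨hz.1, h⟩, rfl⟩
  obtain ⟨T, hT, hTinv, hTη⟩ := exists_smooth_transport hwd hwb
  have hmove : ∀ z ∈ S, ∀ t, ev f z ∈ Metric.ball τ r → t ∈ Metric.ball τ r →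
      T (z, t - ev f z) ∈ S ∧ ev f (T (z, t - ev f z)) = t := by
    intro z hz t hzt ht
    obtain ⟨η, h0, h1, hη⟩ := hTη z (t - ev f z)
    have := mem_and_ev_eq_of_integralCurve hS (O := Metric.ball τ r) Metric.isOpen_ball hwd
      (fun y hy hyO => hw y ⟨hy, Metric.ball_subset_closedBall hyO⟩) hη (h0 ▸ hz)
      (fun s hs => ?_) 1 (right_mem_Icc.2 zero_le_one)
    · rw [h1, h0] at this
      simpa using this
    · rw [h0]
      have := (convex_ball τ r).add_smul_sub_mem hzt ht hs
      rwa [Complex.real_smul] at this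
  have hτr : τ ∈ Metric.ball τ r := Metric.mem_ball_self hr
  refine ⟨Metric.ball τ r, Metric.isOpen_ball, hτr, Metric.ball_subset_closedBall.trans hrS,
    fun z => T (z, τ - ev f z), fun p => T (p.1, p.2 - τ), ?_, ?_, ?_, ?_, ?_, ?_⟩
  · exact fun z hz => hmove z hz.1 τ hz.2 hτr
  · rintro ⟨x, t⟩ ⟨hx, ht⟩
    have hxτ : ev f x = τ := hx.2
    have := hmove x hx.1 t (hxτ ▸ hτr) ht
    rw [hxτ] at this
    exact ⟨this.1, by simpa only [this.2] using ht⟩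
  · exact (hT.comp (contDiff_id.prodMk (contDiff_const.sub (contDiff_ev f)))).contDiffOn
  · exact (hT.comp (contDiff_fst.prodMk (contDiff_snd.sub contDiff_const))).contDiffOn
  · intro z _
    have := hTinv z (τ - ev f z)
    rwa [neg_sub] at this
  · intro x hx t ht
    have hxτ : ev f x = τ := hx.2
    have h1 := hmove x hx.1 t (hxτ ▸ hτr) ht
    rw [hxτ] at h1
    have h2 := hTinv x (t - τ)
    rw [neg_sub] at h2
    exact ⟨by simp only [h1.2, h2], h1.2⟩

theorem criticalValues_subset_of_isLocallyTrivialOff {B : Set ℂ}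
    (hB : IsLocallyTrivialOff S f B) : criticalValues S f ⊆ B := by
  rintro _ ⟨z, ⟨hzS, hz⟩, rfl⟩
  by_contra hzB
  obtain ⟨V, hV, hzV, -, Φ, Ψ, hΦ, hΨ, -, hΨd, hΨΦ, hΦΨ⟩ := hB _ hzB
  have hzp : z ∈ preim S f V := ⟨hzS, hzV⟩
  let γ : ℂ → Aff N := fun t => Ψ (Φ z, t)
  -- The slice `t ↦ Ψ (Φ z, t)` is a section through `z`. Only its real derivative in the direction
  -- 1 is needed.
  have hmaps : MapsTo (fun t : ℂ => (Φ z, t)) V (preim S f {ev f z} ×ˢ V) :=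
    fun t ht => ⟨hΦ hzp, ht⟩
  have hγd : ContDiffOn ℝ ∞ γ V :=
    hΨd.comp (contDiff_const.prodMk contDiff_id).contDiffOn hmaps
  have hγ : HasFDerivAt γ (fderiv ℝ γ (ev f z)) (ev f z) :=
    ((hγd.contDiffAt (hV.mem_nhds hzV)).differentiableAt (by simp)).hasFDerivAt
  have hγz : γ (ev f z) = z := hΨΦ z hzp
  have hcomp : ∀ p : MvPolynomial (Fin N) ℂ, HasFDerivAt (fun t => ev p (γ t))
      (((differential p z).restrictScalars ℝ).comp (fderiv ℝ γ (ev f z))) (ev f z) := by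
    intro p
    have h := ((hasFDerivAt_ev p (γ (ev f z))).restrictScalars ℝ).comp (ev f z) hγ
    rwa [hγz] at h
  have htan : fderiv ℝ γ (ev f z) 1 ∈ tangentSpace S z := by
    intro p hp
    have hc : (fun t => ev p (γ t)) =ᶠ[𝓝 (ev f z)] fun _ => 0 := by
      filter_upwards [hV.mem_nhds hzV] with t ht
      exact hp _ (hΨ (hmaps ht)).1
    exact DFunLike.congr_fun
      ((hcomp p).unique ((hasFDerivAt_const (0 : ℂ) (ev f z)).congr_of_eventuallyEq hc)) 1
  have hone : differential f z (fderiv ℝ γ (ev f z) 1) = 1 := by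
    have hc : (fun t => ev f (γ t)) =ᶠ[𝓝 (ev f z)] id := by
      filter_upwards [hV.mem_nhds hzV] with t ht
      exact (hΦΨ _ (hΦ hzp) t ht).2
    exact DFunLike.congr_fun
      ((hcomp f).unique ((hasFDerivAt_id (ev f z)).congr_of_eventuallyEq hc)) 1
  rw [dRestrict_eq_zero_iff.1 hz _ htan] at hone
  exact zero_ne_one hone

end Triviality
end TameMap
end

/-- The first conjunct says that the bifurcation set really is the smallest finite set off which
the map is a smooth locally trivial fibration. -/
theorem mainTheorem8 (N : ℕ) (S : Set (TameMap.Aff N)) (f : MvPolynomial (Fin N) ℂ)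
    (hS : TameMap.IsSmoothAffineSubvariety S)
    (htame : TameMap.IsTameAtInfinity S f) :
    IsLeast (TameMap.exceptionalSets S f) (TameMap.bifurcationSet S f) ∧
      TameMap.bifurcationSet S f = TameMap.criticalValues S f := by
  have hleast : IsLeast (TameMap.exceptionalSets S f) (TameMap.criticalValues S f) :=
    ⟨⟨TameMap.finite_criticalValues hS.1 htame,
      TameMap.isLocallyTrivialOff_criticalValues hS htame⟩,
      fun _ hB => TameMap.criticalValues_subset_of_isLocallyTrivialOff hB.2⟩
  have heq : TameMap.bifurcationSet S f = TameMap.criticalValues S f :=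
    Set.Subset.antisymm (Set.sInter_subset_of_mem hleast.1)
      (Set.subset_sInter fun _ hB => hleast.2 hB)
  exact ⟨heq ▸ hleast, heq⟩
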